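/- Call a group $G$ \emph{word automatic} (or finite-automaton presentable) if there are a finite alphabet $\Sigma$, a regular language $D\subseteq\Sigma^*$ and a surjection $\nu\colon D\to G$ such that the relations $\{(u,v)\in D^2 : \nu(u)=\nu(v)\}$ and $\{(u,v,w)\in D^3 : \nu(u)\nu(v)=\nu(w)\}$ are recognizable by finite automata that read the words synchronously, letter by letter, the shorter words being padded at the end by a new symbol. (The case where $\nu$ is a bijection is included.) Let $p$ be an odd prime and let $L_p$ be the free nilpotent-of-class-$2$ group of exponent $p$ of infinite rank, i.e. the quotient of a free group $F$ on an infinite set of generators by the normal subgroup generated by all $[[a,b],c]$ and all $a^p$ with $a,b,c\in F$. Then $L_p$ is not word automatic. -/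

import Mathlib

/-- The convolution of `n` words over `Γ`: the words are written one below the other and read
column by column. The result has the length of the longest word; its letter in position `i` is
the `n`-tuple of the `i`-th letters, where `none` is the padding symbol. -/
def wordConvolution {Γ : Type} {n : ℕ} (w : Fin n → List Γ) : List (Fin n → Option Γ) :=
  (List.range (Finset.univ.sup fun j => (w j).length)).map fun i j => (w j)[i]?

/-- An `n`-ary relation on words is recognizable by a finite automaton (reading all words
synchronously, the shorter ones being padded) if the convolutions of its members form a regular
language. -/
def IsFARecognizable {Γ : Type} {n : ℕ} (R : Set (Fin n → List Γ)) : Prop :=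
  Language.IsRegular (wordConvolution '' R : Language (Fin n → Option Γ))

/-- A group is word automatic (FA-presentable) if, for a finite alphabet `Γ`, its elements can be
encoded by the words of a regular language `D` (every element having at least one code) in such
a way that equality of the encoded elements and the graph of the multiplication are recognizable
by finite automata. The values of `ν` outside `D` play no role. -/
def IsWordAutomatic (G : Type*) [Group G] : Prop :=
  ∃ (Γ : Type) (_ : Fintype Γ) (D : Language Γ) (ν : List Γ → G),
    D.IsRegular ∧
    (∀ g : G, ∃ w ∈ D, ν w = g) ∧
    IsFARecognizable {w : Fin 2 → List Γ | (∀ j, w j ∈ D) ∧ ν (w 0) = ν (w 1)} ∧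
    IsFARecognizable {w : Fin 3 → List Γ | (∀ j, w j ∈ D) ∧ ν (w 0) * ν (w 1) = ν (w 2)}

open scoped commutatorElement

/-- All instances in the free group on `ι` of the laws `[[a, b], c] = 1` (nilpotency of class at
most `2`) and `a ^ p = 1` (exponent dividing `p`). -/
def nilTwoExpLaws (p : ℕ) (ι : Type*) : Set (FreeGroup ι) :=
  {g | ∃ a b c : FreeGroup ι, g = ⁅⁅a, b⁆, c⁆} ∪ {g | ∃ a : FreeGroup ι, g = a ^ p}

/-- The free nilpotent-of-class-2 group of exponent `p` with free generators indexed by `ι`: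
the relatively free group on `ι` in the variety given by these laws. -/
abbrev FreeNilTwoExp (p : ℕ) (ι : Type*) : Type _ :=
  PresentedGroup (nilTwoExpLaws p ι)

/-! The proof counts elements with short codes. Let `S m` be the set of elements having a code of
length at most `m`; its size is at most exponential in `m`. Pumping shows that a product of two
elements of `S m` lies in `S (m + c)` for a constant `c`. The relation "same coset of the center" is
first-order definable from the multiplication, so a second pumping argument gives a constant `K`
such that `S (m + K)` meets a coset missed by `S m`, whenever such a coset exists
(`IsWordAutomatic.exists_filtration`).

In `L_p` the central quotient is an infinite-dimensional vector space over the field with `p`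
elements. Hence there are elements `x n`, of depth linear in `n` and linearly independent modulo the
center, such that every combination of the first `n` of them is represented at depth linear in `n`
(`exists_independent_sequence`). The products of `⁅t l, x (r + l)⁆` over `l < r`, with each `t l`
representing an arbitrary combination of `x 0, ..., x (r - 1)`, are `p ^ (r * r)` distinct elements
of depth linear in `r` (`pow_le_ncard`). This exceeds every bound exponential in `r`. -/

/-! ### Convolutions -/

section Words

variable {Γ : Type}

lemma wordConvolution_getElem?_bind {n : ℕ} (w : Fin n → List Γ) (i : ℕ) (j : Fin n) :
    ((wordConvolution w)[i]?).bind (fun c => c j) = (w j)[i]? := by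
  unfold wordConvolution
  rw [List.getElem?_map]
  by_cases h : i < Finset.univ.sup fun j => (w j).length
  · simp [List.getElem?_range h]
  · have h1 : (w j).length ≤ i :=
      le_trans (Finset.le_sup (f := fun j => (w j).length) (Finset.mem_univ j)) (not_lt.mp h)
    rw [List.getElem?_eq_none (by simpa using h), List.getElem?_eq_none h1]
    rfl

lemma wordConvolution_injective {n : ℕ} :
    Function.Injective (wordConvolution : (Fin n → List Γ) → List (Fin n → Option Γ)) := by
  intro w w' h
  funext j
  refine List.ext_getElem? fun i => ?_
  rw [← wordConvolution_getElem?_bind w, ← wordConvolution_getElem?_bind w', h]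

/-- The tuple of words `fun j => a j ++ b j` is cut at position `i` into the prefixes `a j` and
the suffixes `b j`. -/
def IsCut {J : Type} (i : ℕ) (a b : J → List Γ) : Prop :=
  ∀ j, (a j).length ≤ i ∧ ((a j).length < i → b j = [])

lemma IsCut.append_getElem? {J : Type} {i : ℕ} {a b : J → List Γ} (h : IsCut i a b) (j : J)
    (k : ℕ) : (a j ++ b j)[k]? = if k < i then (a j)[k]? else (b j)[k - i]? := by
  obtain ⟨h1, h2⟩ := h j
  rcases h1.lt_or_eq with h3 | h3
  · simp only [h2 h3, List.append_nil, List.getElem?_nil]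
    split_ifs with hk
    · rfl
    · exact List.getElem?_eq_none (by omega)
  · rw [List.getElem?_append, h3]

/-- A nonempty suffix forces its prefix to have length exactly `i`. So either all suffixes are
empty, or the convolution of the prefixes has length exactly `i` and the columns of the suffixes
follow without a shift. -/
lemma IsCut.wordConvolution_append {n : ℕ} {i : ℕ} {a b : Fin n → List Γ} (h : IsCut i a b) :
    wordConvolution (fun j => a j ++ b j) = wordConvolution a ++ wordConvolution b := by
  by_cases hb : ∀ j, b j = []
  · have : wordConvolution b = [] := by simp [wordConvolution, hb]
    simp [this, hb]
  push Not at hb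
  obtain ⟨j, hj⟩ := hb
  have hi : (Finset.univ.sup fun j => (a j).length) = i := by
    refine le_antisymm (Finset.sup_le fun k _ => (h k).1) ?_
    have : ¬ (a j).length < i := fun h' => hj ((h j).2 h')
    exact (not_lt.mp this).trans
      (Finset.le_sup (f := fun j => (a j).length) (Finset.mem_univ j))
  have hs : (Finset.univ.sup fun j => (a j ++ b j).length) =
      i + Finset.univ.sup fun j => (b j).length := by
    apply le_antisymm
    · refine Finset.sup_le fun k _ => ?_
      rw [List.length_append]
      exact add_le_add (h k).1 (Finset.le_sup (f := fun j => (b j).length) (Finset.mem_univ k))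
    · obtain ⟨k, -, hk⟩ := Finset.exists_mem_eq_sup Finset.univ ⟨j, Finset.mem_univ j⟩
        fun j => (b j).length
      have hbj : 0 < (b k).length :=
        (List.length_pos_iff.mpr hj).trans_le
          (hk ▸ Finset.le_sup (f := fun j => (b j).length) (Finset.mem_univ j))
      have hak : ¬ (a k).length < i := fun h' => by simp [(h k).2 h'] at hbj
      have := Finset.le_sup (f := fun j => (a j ++ b j).length) (Finset.mem_univ k)
      simp only [List.length_append] at this ⊢
      rw [hk]
      omega
  unfold wordConvolution
  rw [hs, hi, List.range_add, List.map_append, List.map_map]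
  congr 1
  · refine List.map_congr_left fun k hk => funext fun j => ?_
    rw [h.append_getElem?, if_pos (List.mem_range.mp hk)]
  · refine List.map_congr_left fun k _ => funext fun j => ?_
    simp [h.append_getElem?]

/-! ### Relations on words with finitely many cut types -/

/-- A relation on words has finitely many cut types if, when a tuple of words is cut at some
position, its membership in the relation depends only on the suffixes and on a state, taken from
a finite set, that is determined by the position and the prefixes. -/
def HasFiniteCutTypes {J : Type} (R : (J → List Γ) → Prop) : Prop :=
  ∃ (σ : Type) (_ : Finite σ) (s : ℕ → (J → List Γ) → σ), ∀ i i' a a' b, IsCut i a b →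
    IsCut i' a' b → s i a = s i' a' → R (fun j => a j ++ b j) → R (fun j => a' j ++ b j)

/-- Myhill–Nerode: the state is the left quotient of the language by the convolution of the
prefixes. -/
lemma IsFARecognizable.hasFiniteCutTypes {n : ℕ} {R : Set (Fin n → List Γ)}
    (h : IsFARecognizable R) : HasFiniteCutTypes (fun w => w ∈ R) := by
  set L : Language (Fin n → Option Γ) := wordConvolution '' R with hL
  have hmem : ∀ w, w ∈ R ↔ wordConvolution w ∈ L := fun w =>
    (wordConvolution_injective.mem_set_image).symm
  refine ⟨Set.range L.leftQuotient, (Language.IsRegular.finite_range_leftQuotient h).to_subtype,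
    fun _ a => ⟨L.leftQuotient (wordConvolution a), _, rfl⟩, ?_⟩
  intro i i' a a' b hc hc' hs hR
  rw [hmem, hc.wordConvolution_append, ← Language.mem_leftQuotient] at hR
  rw [hmem, hc'.wordConvolution_append, ← Language.mem_leftQuotient]
  have hs' : L.leftQuotient (wordConvolution a) = L.leftQuotient (wordConvolution a') :=
    congrArg Subtype.val hs
  rwa [← hs']

namespace HasFiniteCutTypes

variable {J J' : Type}

lemma and {R S : (J → List Γ) → Prop} (hR : HasFiniteCutTypes R) (hS : HasFiniteCutTypes S) :
    HasFiniteCutTypes (fun w => R w ∧ S w) := by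
  obtain ⟨σ, _, s, hs⟩ := hR
  obtain ⟨τ, _, t, ht⟩ := hS
  refine ⟨σ × τ, inferInstance, fun i a => (s i a, t i a), ?_⟩
  intro i i' a a' b hc hc' h hw
  rw [Prod.mk.injEq] at h
  exact ⟨hs i i' a a' b hc hc' h.1 hw.1, ht i i' a a' b hc hc' h.2 hw.2⟩

lemma not {R : (J → List Γ) → Prop} (hR : HasFiniteCutTypes R) :
    HasFiniteCutTypes (fun w => ¬ R w) := by
  obtain ⟨σ, hσ, s, hs⟩ := hR
  exact ⟨σ, hσ, s, fun i i' a a' b hc hc' h hw hw' => hw (hs i' i a' a b hc' hc h.symm hw')⟩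

lemma comp {R : (J → List Γ) → Prop} (hR : HasFiniteCutTypes R) (f : J → J') :
    HasFiniteCutTypes (fun w : J' → List Γ => R (fun j => w (f j))) := by
  obtain ⟨σ, hσ, s, hs⟩ := hR
  exact ⟨σ, hσ, fun i a => s i (fun j => a (f j)), fun i i' a a' b hc hc' h hw =>
    hs i i' _ _ (fun j => b (f j)) (fun j => hc (f j)) (fun j => hc' (f j)) h hw⟩

lemma exists_update [DecidableEq J] {R : (J → List Γ) → Prop} (hR : HasFiniteCutTypes R) (j : J) :
    HasFiniteCutTypes (fun w => ∃ z, R (Function.update w j z)) := by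
  obtain ⟨σ, _, s, hs⟩ := hR
  have happ : ∀ (a b : J → List Γ) (c d : List Γ),
      Function.update (fun k => a k ++ b k) j (c ++ d) =
        fun k => Function.update a j c k ++ Function.update b j d k := by
    intro a b c d
    funext k
    by_cases hk : k = j
    · subst hk; simp
    · simp [hk]
  -- Subset construction: all states reachable by guessing a prefix `c` of the witness. The flag
  -- records whether `c` ends before the cut, in which case only an empty suffix may follow.
  refine ⟨Set (σ × Prop), inferInstance, fun i a =>
    {q | ∃ c : List Γ, c.length ≤ i ∧ q = (s i (Function.update a j c), c.length < i)}, ?_⟩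
  rintro i i' a a' b hc hc' h ⟨z, hz⟩
  have hq : (s i (Function.update a j (z.take i)), (z.take i).length < i) ∈
      {q : σ × Prop | ∃ c : List Γ, c.length ≤ i ∧
        q = (s i (Function.update a j c), c.length < i)} := ⟨z.take i, by simp, rfl⟩
  replace hq := (show {q : σ × Prop | _} = {q : σ × Prop | _} from h) ▸ hq
  obtain ⟨c, hci, hq⟩ := hq
  rw [Prod.mk.injEq] at hq
  refine ⟨c ++ z.drop i, ?_⟩
  rw [happ]
  rw [← List.take_append_drop i z, happ] at hz
  refine hs i i' _ _ _ ?_ ?_ hq.1 hz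
  · intro k
    by_cases hk : k = j
    · subst hk
      simp
      omega
    · simpa [hk] using hc k
  · intro k
    by_cases hk : k = j
    · subst hk
      simp only [Function.update_self]
      refine ⟨hci, fun h' => ?_⟩
      rw [← hq.2] at h'
      simp at h' ⊢
      omega
    · simpa [hk] using hc' k

/-- If some word `z` satisfies `R (update w j z)`, then so does one that is longer than the
other words by at most a constant. -/
lemma exists_short_witness [DecidableEq J] {R : (J → List Γ) → Prop} (hR : HasFiniteCutTypes R)
    (j : J) : ∃ N : ℕ, ∀ (w : J → List Γ) (m : ℕ), (∀ k, k ≠ j → (w k).length ≤ m) →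
      R w → ∃ z : List Γ, z.length ≤ m + N ∧ R (Function.update w j z) := by
  obtain ⟨σ, _, s, hs⟩ := hR
  refine ⟨Nat.card σ, fun w m hw hRw => ?_⟩
  have hex : ∃ l, ∃ z : List Γ, z.length = l ∧ R (Function.update w j z) :=
    ⟨_, w j, rfl, by simpa using hRw⟩
  classical
  obtain ⟨z, hzl, hz⟩ := Nat.find_spec hex
  refine ⟨z, ?_, hz⟩
  by_contra! hlt
  -- Beyond position `m` only `z` is still being read. Two cuts with equal states there allow the
  -- segment between them to be removed, against minimality of the length.
  obtain ⟨x, y, hxy, hsxy⟩ : ∃ x y : Fin (Nat.card σ + 1), x < y ∧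
      s (m + x) (Function.update w j (z.take (m + x))) =
        s (m + y) (Function.update w j (z.take (m + y))) := by
    have := Fintype.ofFinite σ
    obtain ⟨x, y, hne, he⟩ := Fintype.exists_ne_map_eq_of_card_lt
      (fun x : Fin (Nat.card σ + 1) => s (m + x) (Function.update w j (z.take (m + x))))
      (by simp [Nat.card_eq_fintype_card])
    rcases lt_or_gt_of_ne hne with h | h
    · exact ⟨x, y, h, he⟩
    · exact ⟨y, x, h, he.symm⟩
  have hy : (y : ℕ) ≤ Nat.card σ := Nat.lt_succ_iff.mp y.2
  have hxy' : (x : ℕ) < y := hxy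
  refine Nat.find_min hex (m := (z.take (m + x) ++ z.drop (m + y)).length) ?_
    ⟨z.take (m + x) ++ z.drop (m + y), rfl, ?_⟩
  · rw [← hzl]
    simp
    omega
  · have happ : ∀ c : List Γ, Function.update w j (c ++ z.drop (m + y)) = fun k =>
        Function.update w j c k ++ Function.update (fun _ => []) j (z.drop (m + y)) k := by
      intro c
      funext k
      by_cases hk : k = j
      · subst hk; simp
      · simp [hk]
    have hcut : ∀ t : ℕ, t ≤ Nat.card σ → IsCut (m + t) (Function.update w j (z.take (m + t)))
        (Function.update (fun _ => []) j (z.drop (m + y))) := by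
      intro t ht k
      by_cases hk : k = j
      · subst hk
        simp
        omega
      · simpa [hk] using (hw k hk).trans (Nat.le_add_right _ _)
    rw [happ]
    refine hs _ _ _ _ _ (hcut y hy) (hcut x (by omega)) hsxy.symm ?_
    rwa [← happ, List.take_append_drop]

/-- If `R` is a reflexive relation on a set of words such that for each `m` some word of the set
is not related to any word of length at most `m`, then there is such a word of length at most
`m + N`, where `N` does not depend on `m`. -/
lemma exists_short_unrelated {R : (Fin 2 → List Γ) → Prop} (hR : HasFiniteCutTypes R) :
    ∃ N : ℕ, ∀ m : ℕ, (∃ x, R ![x, x] ∧ ∀ y, y.length ≤ m → ¬ R ![x, y]) →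
      ∃ x, x.length ≤ m + N ∧ R ![x, x] ∧ ∀ y, y.length ≤ m → ¬ R ![x, y] := by
  obtain ⟨σ, _, s, hs⟩ := hR
  refine ⟨Nat.card (Set σ × σ), fun m hm => ?_⟩
  have hex : ∃ l, ∃ x : List Γ, x.length = l ∧ R ![x, x] ∧ ∀ y, y.length ≤ m → ¬ R ![x, y] := by
    obtain ⟨x, hx⟩ := hm
    exact ⟨_, x, rfl, hx⟩
  classical
  obtain ⟨z, hzl, hzz, hz⟩ := Nat.find_spec hex
  refine ⟨z, ?_, hzz, hz⟩
  by_contra! hlt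
  -- The set of states reached with short words `y` preserves the universal condition when a segment
  -- of `z` is removed; the diagonal state preserves `R ![z, z]`.
  set F : ℕ → Set σ × σ := fun t =>
    ({q | ∃ y : List Γ, y.length ≤ m ∧ q = s (m + t) ![z.take (m + t), y]},
      s (m + t) ![z.take (m + t), z.take (m + t)]) with hF
  obtain ⟨x, y, hxy, hsxy⟩ : ∃ x y : Fin (Nat.card (Set σ × σ) + 1), x < y ∧ F x = F y := by
    have := Fintype.ofFinite (Set σ × σ)
    obtain ⟨x, y, hne, he⟩ := Fintype.exists_ne_map_eq_of_card_lt
      (fun x : Fin (Nat.card (Set σ × σ) + 1) => F x)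
      (by simp only [Nat.card_eq_fintype_card, Fintype.card_fin]; omega)
    rcases lt_or_gt_of_ne hne with h | h
    · exact ⟨x, y, h, he⟩
    · exact ⟨y, x, h, he.symm⟩
  have hy : (y : ℕ) ≤ Nat.card (Set σ × σ) := Nat.lt_succ_iff.mp y.2
  have hxy' : (x : ℕ) < y := hxy
  have happ : ∀ a b c d : List Γ, (![a ++ b, c ++ d] : Fin 2 → List Γ) =
      fun k => (![a, c] : Fin 2 → List Γ) k ++ (![b, d] : Fin 2 → List Γ) k := by
    intro a b c d
    funext k
    fin_cases k <;> rfl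
  have hFx := hsxy
  simp only [hF, Prod.mk.injEq] at hFx
  set b := z.drop (m + y) with hb
  refine Nat.find_min hex (m := (z.take (m + x) ++ b).length) ?_
    ⟨z.take (m + x) ++ b, rfl, ?_, ?_⟩
  · rw [← hzl]
    simp [hb]
    omega
  · rw [happ]
    refine hs _ _ _ _ _ ?_ ?_ hFx.2.symm ?_
    · intro k
      fin_cases k <;> simp [hb] <;> omega
    · intro k
      fin_cases k <;> simp [hb] <;> omega
    · rwa [← happ, hb, List.take_append_drop]
  · intro v hv hRv
    have hq : s (m + x) ![z.take (m + x), v] ∈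
      {q | ∃ y : List Γ, y.length ≤ m ∧ q = s (m + x) ![z.take (m + x), y]} := ⟨v, hv, rfl⟩
    rw [hFx.1] at hq
    obtain ⟨u, hu, hq⟩ := hq
    refine hz u hu ?_
    rw [← List.append_nil v, happ] at hRv
    rw [← List.append_nil u, ← List.take_append_drop (m + y) z, happ]
    refine hs _ _ _ _ _ ?_ ?_ hq hRv
    · intro k
      fin_cases k
      · simp
        omega
      · simp
        omega
    · intro k
      fin_cases k
      · simp
        omega
      · simp
        omega

end HasFiniteCutTypes

end Words

/-! ### Class 2 groups attached to a linear functional -/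

/-- For a linear functional `g` on `V`, the group with underlying set `V × V` and multiplication
`(v, a) * (w, b) = (v + w, a + b + g v • w)`. -/
@[ext]
structure FunctionalExtension {F V : Type*} [Field F] [AddCommGroup V] [Module F V]
    (g : V →ₗ[F] F) where
  /-- The noncentral component. -/
  fst : V
  /-- The central component. -/
  snd : V

namespace FunctionalExtension

variable {F V : Type*} [Field F] [AddCommGroup V] [Module F V] {g : V →ₗ[F] F}

instance : Mul (FunctionalExtension g) :=
  ⟨fun x y => ⟨x.fst + y.fst, x.snd + y.snd + g x.fst • y.fst⟩⟩

instance : One (FunctionalExtension g) := ⟨⟨0, 0⟩⟩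

instance : Inv (FunctionalExtension g) := ⟨fun x => ⟨-x.fst, -x.snd + g x.fst • x.fst⟩⟩

@[simp] lemma fst_mul (x y : FunctionalExtension g) : (x * y).fst = x.fst + y.fst := rfl

@[simp] lemma snd_mul (x y : FunctionalExtension g) :
    (x * y).snd = x.snd + y.snd + g x.fst • y.fst := rfl

@[simp] lemma fst_one : (1 : FunctionalExtension g).fst = 0 := rfl

@[simp] lemma snd_one : (1 : FunctionalExtension g).snd = 0 := rfl

@[simp] lemma fst_inv (x : FunctionalExtension g) : x⁻¹.fst = -x.fst := rfl

@[simp] lemma snd_inv (x : FunctionalExtension g) :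
    x⁻¹.snd = -x.snd + g x.fst • x.fst := rfl

instance : Group (FunctionalExtension g) :=
  Group.ofLeftAxioms
    (fun x y z => by ext <;> simp [add_smul] <;> abel)
    (fun x => by ext <;> simp)
    (fun x => by ext <;> simp)

@[simp] lemma fst_commutator (x y : FunctionalExtension g) : ⁅x, y⁆.fst = 0 := by
  simp [commutatorElement_def]

/-- This is the contraction of `x.fst ∧ y.fst` by `g`. Letting `g` vary, these groups distinguish
products of commutators without the exterior square. -/
lemma snd_commutator (x y : FunctionalExtension g) :
    ⁅x, y⁆.snd = g x.fst • y.fst - g y.fst • x.fst := by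
  simp only [commutatorElement_def, snd_mul, fst_mul, snd_inv, fst_inv, map_add, map_neg,
    add_smul, smul_neg, neg_smul]
  abel

lemma commutator_commutator (x y z : FunctionalExtension g) : ⁅⁅x, y⁆, z⁆ = 1 := by
  ext <;> simp [snd_commutator]

lemma pow_eq (x : FunctionalExtension g) (n : ℕ) :
    x ^ n = ⟨n • x.fst, n • x.snd + n.choose 2 • (g x.fst • x.fst)⟩ := by
  induction n with
  | zero => ext <;> simp
  | succ n ih =>
    rw [pow_succ, ih]
    ext
    · simp [add_smul]
    · simp [add_smul, Nat.choose_succ_succ' n 1, ← Nat.cast_smul_eq_nsmul F, mul_smul]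
      abel

lemma pow_eq_one {p : ℕ} (hp : p.Prime) (hodd : Odd p) [CharP F p]
    (x : FunctionalExtension g) : x ^ p = 1 := by
  -- Oddness gives `2 < p`, so the binomial term in `pow_eq` vanishes.
  have hc : p ∣ p.choose 2 := by
    refine hp.dvd_choose_self two_ne_zero ?_
    have := hp.two_le
    rcases this.lt_or_eq with h | h
    · exact h
    · subst h; exact absurd hodd (by decide)
  rw [pow_eq]
  ext
  · simp [← Nat.cast_smul_eq_nsmul F]
  · simp [← Nat.cast_smul_eq_nsmul F, (CharP.cast_eq_zero_iff F p _).mpr hc]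

end FunctionalExtension

/-! ### The free nilpotent group of class 2 and exponent `p` -/

namespace FreeNilTwoExp

variable {p : ℕ} {ι : Type*}

lemma commutator_commutator (a b c : FreeNilTwoExp p ι) : ⁅⁅a, b⁆, c⁆ = 1 := by
  obtain ⟨a, rfl⟩ := PresentedGroup.mk_surjective _ a
  obtain ⟨b, rfl⟩ := PresentedGroup.mk_surjective _ b
  obtain ⟨c, rfl⟩ := PresentedGroup.mk_surjective _ c
  rw [← map_commutatorElement, ← map_commutatorElement]
  exact PresentedGroup.one_of_mem (Or.inl ⟨a, b, c, rfl⟩)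

lemma pow_eq_one (a : FreeNilTwoExp p ι) : a ^ p = 1 := by
  obtain ⟨a, rfl⟩ := PresentedGroup.mk_surjective _ a
  rw [← map_pow]
  exact PresentedGroup.one_of_mem (Or.inr ⟨a, rfl⟩)

/-- The homomorphism with given values at the generators into a group that satisfies the laws. -/
def lift {H : Type*} [Group H] (hc : ∀ a b c : H, ⁅⁅a, b⁆, c⁆ = 1) (he : ∀ a : H, a ^ p = 1)
    (f : ι → H) : FreeNilTwoExp p ι →* H :=
  PresentedGroup.toGroup (f := f) (by
    rintro r (⟨a, b, c, rfl⟩ | ⟨a, rfl⟩)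
    · rw [map_commutatorElement, map_commutatorElement, hc]
    · rw [map_pow, he])

@[simp] lemma lift_of {H : Type*} [Group H] (hc : ∀ a b c : H, ⁅⁅a, b⁆, c⁆ = 1)
    (he : ∀ a : H, a ^ p = 1) (f : ι → H) (i : ι) :
    lift hc he f (PresentedGroup.of i) = f i :=
  PresentedGroup.toGroup.of _

variable [hp : Fact p.Prime]

variable (p ι) in
/-- The abelianization map onto the vector space with basis `ι` over the prime field. -/
noncomputable def toVec : FreeNilTwoExp p ι →* Multiplicative (ι →₀ ZMod p) :=
  lift (fun a b c => by simp [commutatorElement_eq_one_iff_mul_comm, mul_comm])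
    (fun a => by
      apply Multiplicative.toAdd.injective
      rw [toAdd_pow, ← Nat.cast_smul_eq_nsmul (ZMod p)]
      simp)
    fun i => Multiplicative.ofAdd (Finsupp.single i 1)

/-- The image of an element in the vector space with basis `ι` over the prime field. -/
noncomputable def vec (x : FreeNilTwoExp p ι) : ι →₀ ZMod p := (toVec p ι x).toAdd

@[simp] lemma vec_mul (x y : FreeNilTwoExp p ι) : vec (x * y) = vec x + vec y := by simp [vec]

@[simp] lemma vec_one : vec (1 : FreeNilTwoExp p ι) = 0 := by simp [vec]

@[simp] lemma vec_inv (x : FreeNilTwoExp p ι) : vec x⁻¹ = -vec x := by simp [vec]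

@[simp] lemma vec_of (i : ι) :
    vec (PresentedGroup.of i : FreeNilTwoExp p ι) = Finsupp.single i 1 := by
  simp [vec, toVec]

/-- The homomorphism to the functional extension for `g` that maps the generators to the
basis vectors. -/
noncomputable def toExtension (hodd : Odd p) (g : (ι →₀ ZMod p) →ₗ[ZMod p] ZMod p) :
    FreeNilTwoExp p ι →* FunctionalExtension g :=
  lift FunctionalExtension.commutator_commutator
    (FunctionalExtension.pow_eq_one hp.out hodd) fun i => ⟨Finsupp.single i 1, 0⟩

lemma fst_toExtension (hodd : Odd p) (g : (ι →₀ ZMod p) →ₗ[ZMod p] ZMod p)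
    (x : FreeNilTwoExp p ι) : (toExtension hodd g x).fst = vec x := by
  let fstHom : FunctionalExtension g →* Multiplicative (ι →₀ ZMod p) :=
    { toFun := fun x => Multiplicative.ofAdd x.fst
      map_one' := rfl
      map_mul' := fun _ _ => rfl }
  have h : fstHom.comp (toExtension hodd g) = toVec p ι := by
    refine PresentedGroup.ext fun i => ?_
    simp [fstHom, toExtension, toVec]
  exact congrArg Multiplicative.toAdd (DFunLike.congr_fun h x)

lemma snd_toExtension_commutator (hodd : Odd p) (g : (ι →₀ ZMod p) →ₗ[ZMod p] ZMod p)
    (x y : FreeNilTwoExp p ι) :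
    (toExtension hodd g ⁅x, y⁆).snd = g (vec x) • vec y - g (vec y) • vec x := by
  rw [map_commutatorElement, FunctionalExtension.snd_commutator, fst_toExtension,
    fst_toExtension]

/-- The abelianization has exponent `p`, so it is a vector space and `Abelianization.of` factors
through `toVec`. Thus `x` lies in the commutator subgroup, which is central by the class 2 law. -/
lemma mem_center_of_vec_eq_zero {x : FreeNilTwoExp p ι} (hx : vec x = 0) :
    x ∈ Subgroup.center (FreeNilTwoExp p ι) := by
  let A := Additive (Abelianization (FreeNilTwoExp p ι))
  let _ : Module (ZMod p) A := AddCommGroup.zmodModule (n := p) fun a => by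
    obtain ⟨y, hy⟩ : ∃ y, Abelianization.of y = a.toMul := QuotientGroup.mk_surjective _
    apply Additive.toMul.injective
    rw [toMul_nsmul, ← hy, ← map_pow, pow_eq_one, map_one, toMul_zero]
  let L : (ι →₀ ZMod p) →ₗ[ZMod p] A := Finsupp.linearCombination (ZMod p) fun i =>
    (Additive.ofMul (Abelianization.of (PresentedGroup.of i : FreeNilTwoExp p ι)) : A)
  have h : (AddMonoidHom.toMultiplicativeLeft L.toAddMonoidHom).comp (toVec p ι) =
      Abelianization.of := by
    refine PresentedGroup.ext fun i => ?_
    simp [toVec, L]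
  have h1 : Abelianization.of x = 1 := by
    rw [← h]
    have : toVec p ι x = 1 := hx
    rw [MonoidHom.comp_apply, this, map_one]
  have h2 : x ∈ commutator (FreeNilTwoExp p ι) := by
    rw [← Abelianization.ker_of]; exact h1
  refine (?_ : commutator (FreeNilTwoExp p ι) ≤ _) h2
  rw [commutator_def, Subgroup.commutator_le]
  intro a _ b _
  rw [Subgroup.mem_center_iff]
  intro c
  exact (commutatorElement_eq_one_iff_mul_comm.mp (commutator_commutator a b c)).symm

lemma vec_eq_zero_of_mem_center [Infinite ι] (hodd : Odd p) {x : FreeNilTwoExp p ι}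
    (hx : x ∈ Subgroup.center (FreeNilTwoExp p ι)) : vec x = 0 := by
  by_contra h
  obtain ⟨i, hi⟩ := Finsupp.ne_iff.mp h
  obtain ⟨k, hk⟩ := exists_ne i
  -- With `g` the `i`-th coordinate, the commutator of `x` with the generator `k ≠ i` has `k`-th
  -- coordinate `vec x i`.
  have h1 := snd_toExtension_commutator hodd (Finsupp.lapply i) x (PresentedGroup.of k)
  rw [commutatorElement_eq_one_iff_mul_comm.mpr (Subgroup.mem_center_iff.mp hx _).symm] at h1
  have h2 := DFunLike.congr_fun h1 k
  simp [hk] at h2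
  exact hi h2.symm

end FreeNilTwoExp

/-! ### Elements with short codes in a word automatic group -/

lemma ncard_length_le {Γ : Type} [Fintype Γ] (m : ℕ) :
    {w : List Γ | w.length ≤ m}.ncard ≤ (Fintype.card Γ + 1) ^ m := by
  have h : {w : List Γ | w.length ≤ m}.ncard ≤ (Set.univ : Set (Fin m → Option Γ)).ncard := by
    refine Set.ncard_le_ncard_of_injOn (fun w i => w[(i : ℕ)]?) (fun _ _ => Set.mem_univ _) ?_
    intro w hw w' hw' h
    refine List.ext_getElem? fun i => ?_
    by_cases hi : i < m
    · exact congrFun h ⟨i, hi⟩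
    · rw [List.getElem?_eq_none (le_trans hw (not_lt.mp hi)),
        List.getElem?_eq_none (le_trans hw' (not_lt.mp hi))]
  simpa [Set.ncard_univ, Nat.card_eq_fintype_card] using h

/-- If the graph of a multiplication has finitely many cut types, so has the relation that `y` is
the product of `x` and an element commuting with all elements. -/
lemma HasFiniteCutTypes.exists_mul_commute {Γ : Type} {M : List Γ → List Γ → List Γ → Prop}
    (hM : HasFiniteCutTypes fun w : Fin 3 → List Γ => M (w 0) (w 1) (w 2)) :
    HasFiniteCutTypes fun w : Fin 2 → List Γ =>
      ∃ z, M (w 0) z (w 1) ∧ ¬ ∃ u s, M z u s ∧ ¬ M u z s := by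
  -- The indices `0, 1, 2, 3, 4` stand for `x, y, z, u, s`. The last `comp` fills the places of the
  -- bound variables with a dummy word.
  have hE := ((((hM.comp (![0, 2, 1] : Fin 3 → Fin 5)).and
    ((((hM.comp (![2, 3, 4] : Fin 3 → Fin 5)).and
      (hM.comp (![3, 2, 4] : Fin 3 → Fin 5)).not).exists_update 4).exists_update 3).not
      ).exists_update 2).comp (![0, 1, 0, 0, 0] : Fin 5 → Fin 2))
  simpa [Function.update_apply] using hE

/-- A filtration of a word automatic group: the elements with a code of length at most `m`. -/
lemma IsWordAutomatic.exists_filtration {G : Type*} [Group G] (h : IsWordAutomatic G) :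
    ∃ (S : ℕ → Set G) (b c K : ℕ), Monotone S ∧ (∀ x, ∃ m, x ∈ S m) ∧
      (∀ m, (S m).Finite ∧ (S m).ncard ≤ b ^ m) ∧
      (∀ m, ∀ x ∈ S m, ∀ y ∈ S m, x * y ∈ S (m + c)) ∧
      ∀ m, (∃ x, ∀ y ∈ S m, x⁻¹ * y ∉ Subgroup.center G) →
        ∃ x ∈ S (m + K), ∀ y ∈ S m, x⁻¹ * y ∉ Subgroup.center G := by
  obtain ⟨Γ, _, D, ν, -, hν, -, hM⟩ := h
  set M : List Γ → List Γ → List Γ → Prop := fun x y z =>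
    x ∈ D ∧ y ∈ D ∧ z ∈ D ∧ ν x * ν y = ν z with hMdef
  replace hM : HasFiniteCutTypes fun w : Fin 3 → List Γ => M (w 0) (w 1) (w 2) := by
    simpa [Fin.forall_fin_succ, and_assoc] using hM.hasFiniteCutTypes
  obtain ⟨c, hc⟩ := hM.exists_short_witness 2
  -- By `hE` below, the relation is equality of cosets of the center, and it is reflexive exactly on
  -- `D`.
  obtain ⟨K, hK⟩ := hM.exists_mul_commute.exists_short_unrelated
  have hE : ∀ x y : List Γ, (∃ z, M x z y ∧ ¬ ∃ u s, M z u s ∧ ¬ M u z s) ↔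
      x ∈ D ∧ y ∈ D ∧ (ν x)⁻¹ * ν y ∈ Subgroup.center G := by
    intro x y
    constructor
    · rintro ⟨z, ⟨hx, hz, hy, hxy⟩, hu⟩
      refine ⟨hx, hy, ?_⟩
      rw [← hxy, inv_mul_cancel_left, Subgroup.mem_center_iff]
      intro g
      obtain ⟨u, huD, rfl⟩ := hν g
      obtain ⟨s, hsD, hs⟩ := hν (ν z * ν u)
      by_contra hne
      exact hu ⟨u, s, ⟨hz, huD, hsD, hs.symm⟩, fun h => hne (h.2.2.2.trans hs)⟩
    · rintro ⟨hx, hy, hxy⟩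
      obtain ⟨z, hz, hzν⟩ := hν ((ν x)⁻¹ * ν y)
      refine ⟨z, ⟨hx, hz, hy, by rw [hzν, mul_inv_cancel_left]⟩, ?_⟩
      rintro ⟨u, s, ⟨_, hu, hs, h1⟩, h2⟩
      refine h2 ⟨hu, hz, hs, ?_⟩
      rw [← h1, hzν]
      exact Subgroup.mem_center_iff.mp hxy _
  simp only [Matrix.cons_val_zero, Matrix.cons_val_one, hE, inv_mul_cancel, one_mem, and_true,
    and_self] at hK
  refine ⟨fun m => ν '' {w | w ∈ D ∧ w.length ≤ m}, Fintype.card Γ + 1, c, K, ?_, ?_, ?_, ?_, ?_⟩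
  · rintro m n hmn _ ⟨w, hw, rfl⟩
    exact ⟨w, ⟨hw.1, hw.2.trans hmn⟩, rfl⟩
  · intro x
    obtain ⟨w, hw, rfl⟩ := hν x
    exact ⟨w.length, w, ⟨hw, le_rfl⟩, rfl⟩
  · intro m
    have hfin : {w : List Γ | w.length ≤ m}.Finite := List.finite_length_le Γ m
    have hsub : {w | w ∈ D ∧ w.length ≤ m} ⊆ {w : List Γ | w.length ≤ m} := fun w hw => hw.2
    exact ⟨(hfin.subset hsub).image _, (Set.ncard_image_le (hfin.subset hsub)).trans
      ((Set.ncard_le_ncard hsub hfin).trans (ncard_length_le m))⟩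
  · rintro m _ ⟨x, ⟨hx, hxm⟩, rfl⟩ _ ⟨y, ⟨hy, hym⟩, rfl⟩
    obtain ⟨z, hz, hzν⟩ := hν (ν x * ν y)
    obtain ⟨z', hz', h⟩ := hc ![x, y, z] m
      (fun k hk => by
        fin_cases k
        · exact hxm
        · exact hym
        · exact absurd rfl hk) ⟨hx, hy, hz, hzν.symm⟩
    exact ⟨z', ⟨h.2.2.1, by simpa using hz'⟩, by simpa using h.2.2.2.symm⟩
  · rintro m ⟨x, hx⟩
    obtain ⟨w, hw, rfl⟩ := hν x
    obtain ⟨w', hw', hD, h⟩ := hK m ⟨w, hw, fun y hy h => hx (ν y) ⟨y, ⟨h.2.1, hy⟩, rfl⟩ h.2.2⟩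
    refine ⟨ν w', ⟨w', ⟨hD, hw'⟩, rfl⟩, ?_⟩
    rintro _ ⟨y, ⟨hyD, hy⟩, rfl⟩ hmem
    exact h y hy ⟨hD, hyD, hmem⟩

/-! ### Linear algebra -/

lemma linearIndependent_of_notMem_span_Iio {F V : Type*} [Field F] [AddCommGroup V] [Module F V]
    {v : ℕ → V} (h : ∀ n, v n ∉ Submodule.span F (v '' Set.Iio n)) : LinearIndependent F v := by
  have h1 : ∀ n, LinearIndepOn F v (Set.Iio n) := by
    intro n
    induction n with
    | zero => simp
    | succ n ih =>
      rw [Set.Iio_add_one_eq_Iic, ← Set.Iio_insert]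
      exact ih.insert (h n)
  have h2 : LinearIndepOn F v (⋃ n : ℕ, Set.Iio n) :=
    linearIndepOn_iUnion_of_directed (Monotone.directed_le fun _ _ h => Set.Iio_subset_Iio h) h1
  rwa [Set.iUnion_Iio, linearIndepOn_univ_iff] at h2

lemma LinearIndependent.exists_dual {F V κ : Type*} [Field F] [AddCommGroup V] [Module F V]
    {v : κ → V} (h : LinearIndependent F v) (k : κ) :
    ∃ f : V →ₗ[F] F, f (v k) = 1 ∧ ∀ i, i ≠ k → f (v i) = 0 := by
  obtain ⟨f, hf⟩ := ((Finsupp.lapply k).comp h.repr).exists_extend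
  have hfv : ∀ i, f (v i) = Finsupp.single i (1 : F) k := by
    intro i
    have := LinearMap.congr_fun hf ⟨v i, Submodule.subset_span ⟨i, rfl⟩⟩
    simpa [h.repr_eq_single i] using this
  exact ⟨f, by simp [hfv], fun i hi => by simp [hfv, hi]⟩

lemma pow_succ_mem_filtration {G : Type*} [Monoid G] {S : ℕ → Set G} {c : ℕ}
    (hmul : ∀ m, ∀ x ∈ S m, ∀ y ∈ S m, x * y ∈ S (m + c)) (hmono : Monotone S)
    {m : ℕ} {x : G} (hx : x ∈ S m) (n : ℕ) : x ^ (n + 1) ∈ S (m + n * c) := by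
  induction n with
  | zero => simpa using hx
  | succ n ih =>
    rw [pow_succ]
    refine hmono (le_of_eq ?_) (hmul _ _ ih _ (hmono (Nat.le_add_right m (n * c)) hx))
    ring

/-! ### Many elements of small depth in the free nilpotent group -/

namespace FreeNilTwoExp

variable {p : ℕ} {ι : Type*} [hp : Fact p.Prime]

lemma exists_vec_notMem [Infinite ι] {T : Set (FreeNilTwoExp p ι)} (hT : T.Finite) :
    ∃ x : FreeNilTwoExp p ι, ∀ y ∈ T, vec x ≠ vec y := by
  have hinj : Function.Injective fun i : ι => vec (PresentedGroup.of i : FreeNilTwoExp p ι) := by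
    intro i j hij
    simp only [vec_of] at hij
    exact Finsupp.single_left_injective one_ne_zero hij
  obtain ⟨_, ⟨i, rfl⟩, hi⟩ := (Set.infinite_range_of_injective hinj).exists_notMem_finite
    (hT.image vec)
  exact ⟨PresentedGroup.of i, fun y hy h => hi ⟨y, hy, h.symm⟩⟩

section Filtration

variable {S : ℕ → Set (FreeNilTwoExp p ι)} {c d K : ℕ}

lemma inv_mem (hmul : ∀ m, ∀ x ∈ S m, ∀ y ∈ S m, x * y ∈ S (m + c)) (hmono : Monotone S)
    {m : ℕ} {x : FreeNilTwoExp p ι} (hx : x ∈ S m) : x⁻¹ ∈ S (m + p * c) := by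
  have h : x⁻¹ = x ^ (p - 2 + 1) := by
    rw [inv_eq_iff_mul_eq_one, ← pow_succ', ← pow_eq_one x]
    congr 1
    have := hp.out.two_le
    omega
  rw [h]
  exact hmono (by gcongr; omega) (pow_succ_mem_filtration hmul hmono hx _)

lemma commutator_mem (hmul : ∀ m, ∀ x ∈ S m, ∀ y ∈ S m, x * y ∈ S (m + c)) (hmono : Monotone S)
    {m : ℕ} {x y : FreeNilTwoExp p ι} (hx : x ∈ S m) (hy : y ∈ S m) :
    ⁅x, y⁆ ∈ S (m + p * c + 3 * c) := by
  rw [commutatorElement_def]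
  have hx' := inv_mem hmul hmono hx
  have hy' := inv_mem hmul hmono hy
  have hxy := hmul _ _ hx _ hy
  have h1 := hmul (m + p * c + c) _ (hmono (by omega) hxy) _ (hmono (by omega) hx')
  have h2 := hmul (m + p * c + c + c) _ h1 _ (hmono (by omega) hy')
  exact hmono (by omega) h2

/-- A sequence of elements, the `n`-th one of depth at most `n * K + e` for constants `K` and `e`,
such that all combinations of the first `n` ones have representatives of small depth. -/
lemma exists_independent_sequence
    (hmul : ∀ m, ∀ x ∈ S m, ∀ y ∈ S m, x * y ∈ S (m + c)) (hmono : Monotone S)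
    (hone : 1 ∈ S d) (hgrow : ∀ m, ∃ x ∈ S (m + K), ∀ y ∈ S m, vec x ≠ vec y) {L : ℕ}
    (hL : K + p * c + c ≤ L) :
    ∃ x : ℕ → FreeNilTwoExp p ι, (∀ n, x n ∈ S (n * L + d + K)) ∧
      LinearIndependent (ZMod p) (fun n => vec (x n)) ∧
      ∀ n, ∀ u ∈ Submodule.span (ZMod p) ((fun n => vec (x n)) '' Set.Iio n),
        ∃ y ∈ S (n * L + d), vec y = u := by
  -- No recursion is needed: `x n` avoids all vectors represented in `S (n * L + d)`, and by `hspan`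
  -- these include the whole span of the earlier vectors.
  choose x hx hxy using fun n : ℕ => hgrow (n * L + d)
  have hspan : ∀ n, ∀ u ∈ Submodule.span (ZMod p) ((fun n => vec (x n)) '' Set.Iio n),
        ∃ y ∈ S (n * L + d), vec y = u := by
    intro n
    induction n with
    | zero =>
      intro u hu
      have hu : u = 0 := by simpa using hu
      exact ⟨1, hmono (by omega) hone, by rw [hu, vec_one]⟩
    | succ n ih =>
      intro u hu
      rw [Set.Iio_add_one_eq_Iic, ← Set.Iio_insert, Set.image_insert_eq,
        Submodule.mem_span_insert] at hu
      obtain ⟨a, z, hz, rfl⟩ := hu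
      obtain ⟨y, hy, rfl⟩ := ih z hz
      -- The budget `L` per step pays `K` for the depth of `x n`, `p * c` for its multiple by `a`,
      -- and `c` for the product with `y`.
      have hpow : ∃ t ∈ S (n * L + d + K + p * c), vec t = a • vec (x n) := by
        rcases Nat.eq_zero_or_pos a.val with h | h
        · rw [ZMod.val_eq_zero] at h
          exact ⟨1, hmono (by omega) hone, by simp [h]⟩
        · have hvec : ∀ k : ℕ, vec (x n ^ k) = (k : ZMod p) • vec (x n) := by
            intro k
            induction k with
            | zero => simp
            | succ k ih => rw [pow_succ, vec_mul, ih]; push_cast; rw [add_smul, one_smul]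
          refine ⟨x n ^ (a.val - 1 + 1), hmono ?_ (pow_succ_mem_filtration hmul hmono (hx n) _), ?_⟩
          · have := a.val_lt
            gcongr
            omega
          · rw [hvec, Nat.sub_add_cancel h, ZMod.natCast_zmod_val]
      obtain ⟨t, ht, htv⟩ := hpow
      refine ⟨t * y, hmono ?_ (hmul _ _ ht _ (hmono (by omega) hy)), by rw [vec_mul, htv]⟩
      rw [add_mul]
      omega
  refine ⟨x, hx, linearIndependent_of_notMem_span_Iio fun n hn => ?_, hspan⟩
  obtain ⟨y, hy, hyx⟩ := hspan n _ hn
  exact hxy n y hy hyx.symm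

/-- The factors are multiplied in order of increasing depth bound. Each multiplication costs `c ≤
L`, which the growth of the bound by `L` absorbs, so the depth stays linear in the number of
factors. -/
lemma exists_prod_commutators (hodd : Odd p)
    (hmul : ∀ m, ∀ x ∈ S m, ∀ y ∈ S m, x * y ∈ S (m + c)) (hmono : Monotone S)
    (hone : 1 ∈ S d) {L : ℕ} (hL : c ≤ L) {x : ℕ → FreeNilTwoExp p ι}
    (hx : ∀ n, x n ∈ S (n * L + d + K)) {r : ℕ} {u : ℕ → ι →₀ ZMod p}
    (hu : ∀ l, ∃ y ∈ S (r * L + d), vec y = u l) (j : ℕ) :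
    ∃ y ∈ S ((r + j) * L + d + K + p * c + 3 * c), ∀ g : (ι →₀ ZMod p) →ₗ[ZMod p] ZMod p,
      (toExtension hodd g y).snd = ∑ l ∈ Finset.range j,
        (g (u l) • vec (x (r + l)) - g (vec (x (r + l))) • u l) := by
  induction j with
  | zero => exact ⟨1, hmono (by omega) hone, by simp⟩
  | succ j ih =>
    obtain ⟨y, hy, hyg⟩ := ih
    obtain ⟨t, ht, htu⟩ := hu j
    have hcomm := commutator_mem hmul hmono (m := (r + j) * L + d + K)
      (hmono (by rw [add_mul]; omega) ht) (hx (r + j))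
    refine ⟨y * ⁅t, x (r + j)⁆, hmono ?_ (hmul _ _ hy _ hcomm), fun g => ?_⟩
    · rw [← add_assoc r, add_mul (r + j)]
      omega
    · rw [Finset.sum_range_succ, map_mul, FunctionalExtension.snd_mul, hyg,
        snd_toExtension_commutator, map_commutatorElement, FunctionalExtension.fst_commutator,
        smul_zero, add_zero, htu]

lemma pow_le_ncard (hodd : Odd p) (hfin : ∀ m, (S m).Finite)
    (hmul : ∀ m, ∀ x ∈ S m, ∀ y ∈ S m, x * y ∈ S (m + c)) (hmono : Monotone S)
    (hone : 1 ∈ S d) (hgrow : ∀ m, ∃ x ∈ S (m + K), ∀ y ∈ S m, vec x ≠ vec y) :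
    ∃ L e : ℕ, ∀ r : ℕ, p ^ (r * r) ≤ (S (r * L + e)).ncard := by
  set L := K + p * c + c with hL
  obtain ⟨x, hx, hind, hspan⟩ := exists_independent_sequence hmul hmono hone hgrow hL.ge
  refine ⟨2 * L, d + K + p * c + 3 * c, fun r => ?_⟩
  -- The matrix `a` lists the coefficients of `r` combinations of the first `r` vectors. The value
  -- `0` for `l ≥ r` never matters.
  let u : (Fin r × Fin r → ZMod p) → ℕ → (ι →₀ ZMod p) := fun a l =>
    ∑ i : Fin r, (if h : l < r then a (⟨l, h⟩, i) else 0) • vec (x i)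
  have hu : ∀ a l, u a l ∈ Submodule.span (ZMod p) ((fun n => vec (x n)) '' Set.Iio r) :=
    fun a l => Submodule.sum_mem _ fun i _ =>
      Submodule.smul_mem _ _ (Submodule.subset_span ⟨i, i.2, rfl⟩)
  choose Y hY hYg using fun a =>
    exists_prod_commutators hodd hmul hmono hone (by omega : c ≤ L) hx
      (fun l => hspan r _ (hu a l)) r
  -- A functional dual to `vec (x (r + l))` kills every `u a k` and the other `vec (x (r + k))`, so
  -- it isolates `u a l`. Hence the product determines `a`.
  have hval : ∀ (l : Fin r) (g : (ι →₀ ZMod p) →ₗ[ZMod p] ZMod p), g (vec (x (r + l))) = 1 →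
      (∀ i, i ≠ r + (l : ℕ) → g (vec (x i)) = 0) →
      ∀ a, (toExtension hodd g (Y a)).snd = -u a l := by
    intro l g hg1 hg0 a
    have hgu : ∀ k, g (u a k) = 0 := by
      intro k
      simp only [u, map_sum, map_smul]
      exact Finset.sum_eq_zero fun i _ => by rw [hg0 i (by omega), smul_zero]
    rw [hYg, Finset.sum_eq_single (l : ℕ)]
    · rw [hgu, hg1]; simp
    · intro k _ hk
      rw [hgu, hg0 _ (by omega)]; simp
    · intro h
      exact absurd (Finset.mem_range.mpr l.2) h
  have hinj : Function.Injective Y := by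
    intro a a' h
    funext ⟨l, i⟩
    obtain ⟨g, hg1, hg0⟩ := hind.exists_dual (r + (l : ℕ))
    have h1 : u a l = u a' l := by
      rw [← neg_inj, ← hval l g hg1 hg0, ← hval l g hg1 hg0, h]
    have hind' := hind.comp (fun i : Fin r => (i : ℕ)) Fin.val_injective
    have h2 := Fintype.linearIndependent_iff.mp hind'
      (fun i => a (l, i) - a' (l, i)) (by
        simp only [u, Fin.is_lt, dif_pos] at h1
        simp only [sub_smul, Finset.sum_sub_distrib, Function.comp_apply]
        exact sub_eq_zero.mpr h1) i
    exact sub_eq_zero.mp h2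
  have hcard := Set.ncard_le_ncard_of_injOn (s := Set.univ) (t := S (r * (2 * L) +
    (d + K + p * c + 3 * c))) Y (fun a _ => hmono (by ring_nf; omega) (hY a))
    hinj.injOn (hfin _)
  simpa [Set.ncard_univ, Nat.card_eq_fintype_card, ZMod.card] using hcard

end Filtration

end FreeNilTwoExp

lemma exists_pow_lt_pow_mul_self (b L e : ℕ) {p : ℕ} (hp : 2 ≤ p) :
    ∃ r : ℕ, b ^ (r * L + e) < p ^ (r * r) := by
  refine ⟨b * (L + e) + 1, ?_⟩
  set r := b * (L + e) + 1 with hr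
  calc b ^ (r * L + e) ≤ (2 ^ b) ^ (r * L + e) := Nat.pow_le_pow_left Nat.lt_two_pow_self.le _
    _ = 2 ^ (b * (r * L + e)) := (pow_mul _ _ _).symm
    _ < 2 ^ (r * r) := by
      refine Nat.pow_lt_pow_right (by norm_num) ?_
      have h1 : 1 ≤ r := by omega
      calc b * (r * L + e) ≤ b * (r * L + r * e) := by gcongr; exact Nat.le_mul_of_pos_left _ h1
        _ = (b * (L + e)) * r := by ring
        _ < r * r := by gcongr; omega
    _ ≤ p ^ (r * r) := Nat.pow_le_pow_left hp _

theorem mainTheorem3 (p : ℕ) (hp : p.Prime) (hodd : Odd p) (ι : Type*) [Infinite ι] :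
    ¬ IsWordAutomatic (FreeNilTwoExp p ι) := by
  intro h
  have : Fact p.Prime := ⟨hp⟩
  obtain ⟨S, b, c, K, hmono, hex, hcard, hmul, hgrow⟩ := h.exists_filtration
  obtain ⟨d, hd⟩ := hex 1
  have hcenter : ∀ x y : FreeNilTwoExp p ι, x⁻¹ * y ∈ Subgroup.center (FreeNilTwoExp p ι) ↔
      x.vec = y.vec := by
    intro x y
    have hv : (x⁻¹ * y).vec = y.vec - x.vec := by simp [neg_add_eq_sub]
    constructor
    · intro hxy
      have := FreeNilTwoExp.vec_eq_zero_of_mem_center hodd hxy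
      rw [hv, sub_eq_zero] at this
      exact this.symm
    · intro hxy
      exact FreeNilTwoExp.mem_center_of_vec_eq_zero (by rw [hv, hxy, sub_self])
  -- Cosets of the center are the fibres of `vec`, so the growth property becomes one about vectors.
  simp only [hcenter] at hgrow
  obtain ⟨L, e, hle⟩ := FreeNilTwoExp.pow_le_ncard hodd (fun m => (hcard m).1) hmul hmono hd
    fun m => hgrow m (FreeNilTwoExp.exists_vec_notMem (hcard m).1)
  obtain ⟨r, hr⟩ := exists_pow_lt_pow_mul_self b L e hp.two_le
  exact absurd (hle r) (not_le.mpr (((hcard _).2).trans_lt hr))
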